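/- Conventions. All graphs are finite and simple; $\mathcal T_n$ is the family of $n$-vertex trees; a graph is $\mathcal T_n$-universal if it contains every tree in $\mathcal T_n$ as a (not necessarily induced) subgraph; $s(n)$ is the minimum number of edges of an $n$-vertex $\mathcal T_n$-universal graph. Let $B(k)$ be the rooted perfect binary tree of level $k$ (it has $2^{k+1}-1$ vertices), with vertices ordered by DFS preorder. Let $D[u]$ be the set of descendants of a vertex $u$, including $u$, and $D(u)=D[u]\setminus\{u\}$. Let $u^*$ be the parent of $u$. The nearest left cousin $l(u)$ of $u$ is the last vertex before $u$ in the DFS preorder that has the same level as $u$ (if there is one). Let $G_{B(k)}$ be the simple graph on $V(B(k))$ in which every vertex $u$ is joined to (G1) every vertex of $D(u)$; (G2) every vertex of $D[w]$, for each left sibling $w$ of $u$; (G3) every vertex of $D[l(u^*)]$, if $u$ has a parent $u^*$ and $u^*$ has a nearest left cousin $l(u^*)$. A set of vertices of $B(k)$ is admissible if it is an initial segment of the DFS preorder, and a subgraph $G$ of $G_{B(k)}$ is admissible if it is induced by an admissible set. Put $D_G(u)=V(G)\cap D(u)$. Theorem. (a) Let $k\ge 0$, let $G$ be an admissible subgraph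 of $G_{B(k)}$, let $T$ be a tree with $|T|\le |G|$, and let $v\in V(T)$. Then there is an injective homomorphism $\lambda:V(T)\to V(G)$ such that $V(G)\setminus\lambda(V(T))$ is admissible and: if $|T|=|G|$, then $\lambda(v)$ is the root of $B(k)$; if $|T|<|G|$, then $\lambda(v)$ is the last vertex $x$ of $\lambda(V(T))$ in the DFS preorder such that $|D_G(x)|<|T|$ and, if $x$ has a parent $x^*$, also $|T|\le|D_G(x^*)|$. (b) For all $k\ge 0$ and $n$, every $n$-vertex admissible subgraph of $G_{B(k)}$ is $\mathcal T_n$-universal. (c) There is an absolute constant $C$ such that, for all integers $n\ge1$ and $k\ge 0$ with $2^k\le n<2^{k+1}$, there is an $n$-vertex admissible subgraph of $G_{B(k)}$; it is $\mathcal T_n$-universal and has at most $\tfrac72 n\log_2 n+Cn$ edges. Moreover, for every $n \ge 0$, $$s(n)\le \tfrac72\,n\log_2 n+Cn$$ (with the convention $0\log_2 0=0$), that is, $s(n)\le\tfrac72 n\log_2 n+O(n)$. -/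

import Mathlib

/-- A finite rooted tree whose children are ordered from left to right. A vertex is the address of
a node, i.e. the list of the labels of the edges on the path from the root to it (the root is `[]`,
the children of `u` are the vertices `u ++ [a]`, ordered from left to right by `a`).  Vertices are
compared by the lexicographic order of addresses, in which a list is preceded by its prefixes: this
is the DFS preorder. -/
structure DFSTree (α : Type) [LinearOrder α] where
  verts : Finset (List α)
  root_mem : [] ∈ verts
  mem_of_prefix : ∀ {u w : List α}, u <+: w → w ∈ verts → u ∈ verts

namespace DFSTree

variable {α : Type} [LinearOrder α] (T : DFSTree α)

/-- The vertices of `T`; the order `<` on this type is the DFS preorder. -/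
abbrev V : Type := {u : List α // u ∈ T.verts}

/-- The root of `T`. -/
def root : T.V := ⟨[], T.root_mem⟩

variable {T}

/-- The level of `u`: its distance to the root. -/
def level (u : T.V) : ℕ := u.1.length

/-- `p` is the parent of `u`. -/
def IsParent (p u : T.V) : Prop := ∃ a : α, u.1 = p.1 ++ [a]

/-- `D_T[u]`: the descendants of `u`, including `u`. -/
def closedDesc (u : T.V) : Set T.V := {w | u.1 <+: w.1}

/-- `D_T(u)`: the descendants of `u` other than `u`. -/
def desc (u : T.V) : Set T.V := closedDesc u \ {u}

/-- `w` is a left-sibling of `u`. -/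
def IsLeftSibling (w u : T.V) : Prop := (∃ p : T.V, IsParent p w ∧ IsParent p u) ∧ w < u

/-- `w` is a left-cousin of `u`. -/
def IsLeftCousin (w u : T.V) : Prop := level w = level u ∧ w < u

/-- `w` is the nearest left-cousin `l(u)` of `u`. -/
def IsNearestLeftCousin (w u : T.V) : Prop := IsGreatest {x : T.V | IsLeftCousin x u} w

/-- The arcs `u → w`: to the proper descendants of `u`; to the left-siblings of `u` and their
descendants; to the nearest left-cousin of the parent of `u` and its descendants. -/
def Arc (u w : T.V) : Prop :=
  w ∈ desc u ∨
  (∃ x : T.V, IsLeftSibling x u ∧ w ∈ closedDesc x) ∨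
  (∃ p x : T.V, IsParent p u ∧ IsNearestLeftCousin x p ∧ w ∈ closedDesc x)

variable (T)

/-- The graph `G_T` generated by `T`: the simple graph underlying the digraph of arcs. -/
def generatedGraph : SimpleGraph T.V := SimpleGraph.fromRel Arc

variable {T}

/-- A set of vertices is admissible if it is an initial segment of the DFS preorder. -/
def Admissible (S : Finset T.V) : Prop := IsLowerSet (S : Set T.V)

/-- `φ` embeds the graph `H` into the subgraph of `G_T` induced by `S`, and the vertices of `S`
that it leaves uncovered form an admissible set. -/
structure IsAdmissibleEmbedding {W : Type} (H : SimpleGraph W) (S : Finset T.V) (φ : W → T.V) :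
    Prop where
  injective : Function.Injective φ
  mem : ∀ a, φ a ∈ S
  map_adj : ∀ a b, H.Adj a b → T.generatedGraph.Adj (φ a) (φ b)
  admissible_compl : IsLowerSet ((S : Set T.V) \ Set.range φ)

/-- `|D_G(u)|` for the subgraph `G` induced by `S`: the number of proper descendants of `u`
in `S`. -/
noncomputable def descCard (S : Finset T.V) (u : T.V) : ℕ := ((S : Set T.V) ∩ desc u).ncard

end DFSTree

/-- The perfect binary tree `B(k)` of level `k`: all `0`-`1` addresses of length at most `k`. -/
noncomputable def perfectBinaryTree (k : ℕ) : DFSTree Bool where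
  verts := (List.finite_length_le Bool k).toFinset
  root_mem := by simp
  mem_of_prefix := by
    intro u w h hw
    simp only [Set.Finite.mem_toFinset, Set.mem_ofPred_eq] at hw ⊢
    exact h.length_le.trans hw

/-- `G` contains every `n`-vertex tree. -/
def TreeUniversal (n : ℕ) {U : Type} (G : SimpleGraph U) : Prop :=
  ∀ H : SimpleGraph (Fin n), H.IsTree → H.IsContained G

/-- `s(n)`: the minimum number of edges in an `n`-vertex graph containing every `n`-vertex tree. -/
noncomputable def minUniversalEdges (n : ℕ) : ℕ :=
  sInf {e : ℕ | ∃ G : SimpleGraph (Fin n), TreeUniversal n G ∧ G.edgeSet.ncard = e}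

/-- The minimum defining `s(n)` is attained. -/
theorem exists_minUniversalEdges (n : ℕ) :
    ∃ G : SimpleGraph (Fin n), TreeUniversal n G ∧ G.edgeSet.ncard = minUniversalEdges n := by
  have h : {e : ℕ | ∃ G : SimpleGraph (Fin n),
      TreeUniversal n G ∧ G.edgeSet.ncard = e}.Nonempty :=
    ⟨_, ⊤, fun H _ => SimpleGraph.IsContained.of_le le_top, rfl⟩
  exact Nat.sInf_mem h

/-! Number the vertices of B(k) in preorder, so that an n-vertex admissible graph lives on the
positions 0, ..., n - 1. The embedding lemma `finalEmbeds` is proved in a stronger form, for vertex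
sets A of an acyclic graph: A goes onto the last |A| of the first n positions, with v at `rootPos`.
The induction is on |A| and, inside it, on k. If A fills all positions, v takes the root; if A fits
into the left or right subtree in use, k decreases.

Otherwise v goes to the right child of the root, which is adjacent to everything below the root. Let
s be the number of available positions in the last subtree below that child. A forest with at least
s vertices has a set Q of between s and 2s - 1 vertices attached to the rest at a single vertex w
(`exists_isPendant`). By induction Q occupies the final positions with w at the root of that last
subtree, and this position is adjacent to all positions used by A without Q and v. If the last
subtree is the left one under the right child, Q may spill over into the right subtree of the left
child; by (G3) these two middle subtrees carry at least the adjacencies of two sibling subtrees.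

For the edge count, charge each arc to its source u, and let w(u) be 2 to the height of u plus one,
a bound on |D[u]|. The rules give at most w(u), w(u) (right children only) and 2w(u) arcs. Right
children carry at most half of the total weight, whence the factor 7/2, and the total weight is at
most (k + 1)n + O(n). -/

/-! ### Recursive coordinates on the perfect binary tree -/

/-- Arcs from the right subtree of a vertex to its left subtree, by relative addresses. -/
inductive CrossArc : List Bool → List Bool → Prop
  | nil (w : List Bool) : CrossArc [] w
  | single (c : Bool) (w : List Bool) : CrossArc [c] w
  | cons {u w : List Bool} : CrossArc u w → CrossArc (false :: u) (true :: w)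

/-- A recursive description of the arcs between addresses of a perfect binary tree. -/
inductive TreeArc : List Bool → List Bool → Prop
  | root (c : Bool) (w : List Bool) : TreeArc [] (c :: w)
  | cons (c : Bool) {u w : List Bool} : TreeArc u w → TreeArc (c :: u) (c :: w)
  | cross {u w : List Bool} : CrossArc u w → TreeArc (true :: u) (false :: w)

/-- The number of vertices of `B(k)`. -/
def treeSize : ℕ → ℕ
  | 0 => 1
  | k + 1 => 2 * treeSize k + 1

/-- The address of the `i`-th vertex of `B(k)` in the DFS preorder. -/
def addr : ℕ → ℕ → List Bool
  | 0, _ => []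
  | k + 1, i => if i = 0 then [] else if i ≤ treeSize k then false :: addr k (i - 1)
      else true :: addr k (i - 1 - treeSize k)

/-- Adjacency of the `i`-th and the `j`-th vertex of `B(k)`. -/
def PosAdj (k i j : ℕ) : Prop :=
  TreeArc (addr k i) (addr k j) ∨ TreeArc (addr k j) (addr k i)

/-- The position of the image of the distinguished vertex when a tree with `m` vertices is embedded
into the first `n` vertices of `B(k)`. -/
def rootPos : ℕ → ℕ → ℕ → ℕ
  | 0, _, _ => 0
  | k + 1, n, m =>
    if m = n then 0
    else if n ≤ 1 + treeSize k then 1 + rootPos k (n - 1) m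
    else if m ≤ n - 1 - treeSize k then 1 + treeSize k + rootPos k (n - 1 - treeSize k) m
    else 1 + treeSize k

theorem treeSize_succ (k : ℕ) : treeSize (k + 1) = 2 * treeSize k + 1 := rfl

theorem treeSize_pos (k : ℕ) : 0 < treeSize k := by
  cases k <;> simp [treeSize]

theorem treeSize_eq (k : ℕ) : treeSize k + 1 = 2 ^ (k + 1) := by
  induction k with
  | zero => rfl
  | succ k ih => rw [treeSize_succ, pow_succ, ← ih]; ring

theorem addr_zero (k : ℕ) : addr k 0 = [] := by cases k <;> simp [addr]

theorem addr_left {k i : ℕ} (h : i < treeSize k) : addr (k + 1) (1 + i) = false :: addr k i := by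
  have h1 : ¬ (1 + i = 0) := by omega
  have h2 : 1 + i ≤ treeSize k := by omega
  have h3 : 1 + i - 1 = i := by omega
  simp only [addr, if_neg h1, if_pos h2, h3]

theorem addr_right (k i : ℕ) : addr (k + 1) (1 + treeSize k + i) = true :: addr k i := by
  have h1 : ¬ (1 + treeSize k + i = 0) := by omega
  have h2 : ¬ (1 + treeSize k + i ≤ treeSize k) := by omega
  have h3 : 1 + treeSize k + i - 1 - treeSize k = i := by omega
  simp only [addr, if_neg h1, if_neg h2, h3]

theorem rootPos_self (k n : ℕ) : rootPos k n n = 0 := by cases k <;> simp [rootPos]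

theorem rootPos_of_le {k n m : ℕ} (h : m < n) (hn : n ≤ 1 + treeSize k) :
    rootPos (k + 1) n m = 1 + rootPos k (n - 1) m := by
  simp [rootPos, h.ne, hn]

/-- The boundary value m = n - 1 - `treeSize k` is included: there the recursion enters the right
subtree and stops at its root, the same position. -/
theorem rootPos_cross {k n m : ℕ} (h : m < n) (hn : 1 + treeSize k < n)
    (hm : n - 1 - treeSize k ≤ m) : rootPos (k + 1) n m = 1 + treeSize k := by
  have h2 : ¬ (n ≤ 1 + treeSize k) := by omega
  by_cases h1 : m ≤ n - 1 - treeSize k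
  · have h3 : n - 1 - treeSize k = m := by omega
    simp [rootPos, h.ne, h2, h3, rootPos_self]
  · simp [rootPos, h.ne, h2, h1]

theorem rootPos_sub {k n m : ℕ} (hn : 1 + treeSize k < n)
    (hm : m ≤ n - 1 - treeSize k) :
    rootPos (k + 1) n m = 1 + treeSize k + rootPos k (n - 1 - treeSize k) m := by
  have h1 : m ≠ n := by omega
  have h2 : ¬ (n ≤ 1 + treeSize k) := by omega
  simp [rootPos, h1, h2, hm]

/-! ### Vertices adjacent to large intervals of positions -/

namespace PosAdj

variable {k i j : ℕ}

theorem symm (h : PosAdj k i j) : PosAdj k j i := Or.symm h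

theorem left (hi : i < treeSize k) (hj : j < treeSize k) (h : PosAdj k i j) :
    PosAdj (k + 1) (1 + i) (1 + j) := by
  unfold PosAdj
  rw [addr_left hi, addr_left hj]
  exact h.imp (TreeArc.cons _) (TreeArc.cons _)

theorem right (h : PosAdj k i j) :
    PosAdj (k + 1) (1 + treeSize k + i) (1 + treeSize k + j) := by
  unfold PosAdj
  rw [addr_right, addr_right]
  exact h.imp (TreeArc.cons _) (TreeArc.cons _)

theorem root (k : ℕ) (h : 0 < j) (hj : j < treeSize k) : PosAdj k 0 j := by
  cases k with
  | zero => simp [treeSize] at hj; omega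
  | succ k =>
    left
    rw [addr_zero]
    by_cases h1 : j ≤ treeSize k
    · obtain ⟨i, rfl⟩ := Nat.exists_eq_add_of_le h
      rw [addr_left (by omega)]
      exact TreeArc.root _ _
    · obtain ⟨i, rfl⟩ : ∃ i, j = 1 + treeSize k + i := Nat.exists_eq_add_of_le (by omega)
      rw [addr_right]
      exact TreeArc.root _ _

/-- The right child of the root is adjacent to all vertices below the root. -/
theorem rightChild (h : 0 < j) (hne : j ≠ 1 + treeSize k) (hj : j < treeSize (k + 1)) :
    PosAdj (k + 1) (1 + treeSize k) j := by
  rw [treeSize_succ] at hj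
  by_cases h1 : j ≤ treeSize k
  · left
    obtain ⟨i, rfl⟩ := Nat.exists_eq_add_of_le h
    have := addr_right k 0
    rw [add_zero] at this
    rw [this, addr_left (by omega), addr_zero]
    exact TreeArc.cross (CrossArc.nil _)
  · obtain ⟨i, rfl⟩ : ∃ i, j = 1 + treeSize k + i := Nat.exists_eq_add_of_le (by omega)
    exact (root k (by omega) (by omega)).right

/-- The left child of the right child is adjacent to the left subtree. -/
theorem rightLeft (h : 0 < j) (hj : j ≤ treeSize (k + 1)) :
    PosAdj (k + 2) (1 + treeSize (k + 1) + 1) j := by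
  left
  obtain ⟨i, rfl⟩ := Nat.exists_eq_add_of_le h
  have := addr_left (k := k) (i := 0) (treeSize_pos k)
  rw [add_zero] at this
  rw [addr_left (by omega), addr_right, this, addr_zero]
  exact TreeArc.cross (CrossArc.single _ _)

/-- The right child of the right child is adjacent to the left subtree and to the subtree of its
left sibling. -/
theorem rightRight (h : 0 < j) (hne : j ≠ 1 + treeSize (k + 1))
    (hj : j < 1 + treeSize (k + 1) + (1 + treeSize k)) :
    PosAdj (k + 2) (1 + treeSize (k + 1) + (1 + treeSize k)) j := by
  by_cases h1 : j ≤ treeSize (k + 1)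
  · left
    obtain ⟨i, rfl⟩ := Nat.exists_eq_add_of_le h
    have := addr_right k 0
    rw [add_zero] at this
    rw [addr_left (by omega), addr_right, this, addr_zero]
    exact TreeArc.cross (CrossArc.single _ _)
  · obtain ⟨i, rfl⟩ : ∃ i, j = 1 + treeSize (k + 1) + i := Nat.exists_eq_add_of_le (by omega)
    exact (rightChild (by omega) (by omega) (by rw [treeSize_succ]; omega)).right

end PosAdj

/-! ### The two middle subtrees -/

/-- The map that sends the two subtrees of the root of `B(k + 1)` to the middle two of the four
subtrees of level `k` of `B(k + 2)`. -/
def middlePos (k i : ℕ) : ℕ := if i ≤ treeSize k then i + treeSize k + 1 else i + treeSize k + 2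

theorem addr_middlePos {k i : ℕ} (h : 0 < i) (hi : i < treeSize (k + 1)) :
    ∃ c u, addr (k + 1) i = c :: u ∧ addr (k + 2) (middlePos k i) = c :: (!c) :: u := by
  rw [treeSize_succ] at hi
  by_cases h1 : i ≤ treeSize k
  · obtain ⟨i, rfl⟩ := Nat.exists_eq_add_of_le h
    refine ⟨false, addr k i, addr_left (by omega), ?_⟩
    rw [middlePos, if_pos h1, show 0 + 1 + i + treeSize k + 1 = 1 + (1 + treeSize k + i) by ring,
      addr_left (by rw [treeSize_succ]; omega), addr_right]
    rfl
  · obtain ⟨i, rfl⟩ : ∃ j, i = 1 + treeSize k + j := Nat.exists_eq_add_of_le (by omega)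
    refine ⟨true, addr k i, addr_right _ _, ?_⟩
    rw [middlePos, if_neg h1, show 1 + treeSize k + i + treeSize k + 2
      = 1 + treeSize (k + 1) + (1 + i) by rw [treeSize_succ]; ring, addr_right,
      addr_left (by omega)]
    rfl

/-- The middle subtrees hang at 01 and 10, which are consecutive on their level. An arc inside one
subtree is carried along unchanged, and an arc across siblings becomes one across the middle by
`CrossArc.cons`. -/
theorem TreeArc.middle {c d : Bool} {u w : List Bool} (h : TreeArc (c :: u) (d :: w)) :
    TreeArc (c :: (!c) :: u) (d :: (!d) :: w) := by
  cases h with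
  | cons _ h => exact .cons _ (.cons _ h)
  | cross h => exact .cross (.cons h)

theorem PosAdj.middle {k i j : ℕ} (hi0 : 0 < i) (hi : i < treeSize (k + 1)) (hj0 : 0 < j)
    (hj : j < treeSize (k + 1)) (h : PosAdj (k + 1) i j) :
    PosAdj (k + 2) (middlePos k i) (middlePos k j) := by
  obtain ⟨c, u, h1, h2⟩ := addr_middlePos hi0 hi
  obtain ⟨d, w, h3, h4⟩ := addr_middlePos hj0 hj
  unfold PosAdj at h ⊢
  rw [h1, h3] at h
  rw [h2, h4]
  exact h.imp TreeArc.middle TreeArc.middle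

theorem middlePos_injective (k : ℕ) : Function.Injective (middlePos k) := by
  intro i j h
  unfold middlePos at h
  split_ifs at h <;> omega

/-! ### Pendant sets in forests -/

section Separator

variable {V : Type*} [DecidableEq V] {H : SimpleGraph V}

/-- A set of vertices of a forest that is attached to the rest of `F` at one vertex only. -/
def IsPendant (H : SimpleGraph V) (F Q : Finset V) (w : V) : Prop :=
  Q ⊆ F ∧ w ∈ Q ∧ ∀ x ∈ Q, x ≠ w → ∀ y ∈ F, y ∉ Q → ¬ H.Adj x y

/-- A pendant set with at least two vertices splits into two pendant sets. -/
theorem IsPendant.exists_split (hH : H.IsAcyclic) {F Q : Finset V} {w : V}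
    (hQ : IsPendant H F Q w) (h2 : 2 ≤ Q.card) :
    ∃ C ⊂ Q, C.Nonempty ∧ (∃ c, IsPendant H F C c) ∧ IsPendant H F (Q \ C) w := by
  classical
  obtain ⟨hQF, hw, hpend⟩ := hQ
  obtain ⟨y, hyQ, hyw⟩ := Finset.exists_mem_ne h2 w
  let K : SimpleGraph V :=
    { Adj := fun a b => H.Adj a b ∧ (a ∈ Q ∧ a ≠ w) ∧ (b ∈ Q ∧ b ≠ w)
      symm := ⟨fun a b h => ⟨h.1.symm, h.2.2, h.2.1⟩⟩
      loopless := ⟨fun a h => H.loopless.irrefl a h.1⟩ }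
  let C := Q.filter fun z => z ≠ w ∧ K.Reachable y z
  have hCmem : ∀ z, z ∈ C ↔ z ∈ Q ∧ z ≠ w ∧ K.Reachable y z := fun z => by simp [C]
  have hyC : y ∈ C := (hCmem y).2 ⟨hyQ, hyw, SimpleGraph.Reachable.refl y⟩
  have hwC : w ∉ C := fun h => ((hCmem w).1 h).2.1 rfl
  have hCQ : C ⊆ Q := Finset.filter_subset _ _
  have hclosed : ∀ a ∈ C, ∀ b ∈ Q, b ≠ w → H.Adj a b → b ∈ C := by
    intro a ha b hb hbw hab
    obtain ⟨haQ, haw, har⟩ := (hCmem a).1 ha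
    exact (hCmem b).2 ⟨hb, hbw, har.trans
      (SimpleGraph.Adj.reachable (G := K) ⟨hab, ⟨haQ, haw⟩, hb, hbw⟩)⟩
  -- If w had two neighbours a, b in C, the edge wb and a path from b to a avoiding w would bypass
  -- the edge wa, which is a bridge of the forest.
  have huniq : ∀ a ∈ C, ∀ b ∈ C, H.Adj w a → H.Adj w b → a = b := by
    intro a ha b hb hwa hwb
    by_contra hne
    have hbr := SimpleGraph.isAcyclic_iff_forall_adj_isBridge.1 hH hwa
    rw [SimpleGraph.isBridge_iff] at hbr
    apply hbr
    have hK : K ≤ H \ SimpleGraph.fromEdgeSet {s(w, a)} := by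
      intro p q hpq
      refine ⟨hpq.1, fun h => ?_⟩
      have h' : s(p, q) = s(w, a) := h.1
      rw [Sym2.eq_iff] at h'
      rcases h' with h' | h'
      · exact hpq.2.1.2 h'.1
      · exact hpq.2.2.2 h'.2
    have hba : K.Reachable b a := ((hCmem b).1 hb).2.2.symm.trans ((hCmem a).1 ha).2.2
    refine SimpleGraph.Reachable.trans (SimpleGraph.Adj.reachable ?_) (hba.mono hK)
    refine ⟨hwb, fun h => ?_⟩
    have h' : s(w, b) = s(w, a) := h.1
    rw [Sym2.eq_iff] at h'
    rcases h' with h' | h'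
    · exact hne h'.2.symm
    · exact hwa.ne h'.1
  refine ⟨C, ⟨hCQ, fun h => hwC (h hw)⟩, ⟨y, hyC⟩, ?_, ?_⟩
  -- The attachment vertex of C is its neighbour of w; if there is none, any vertex of C serves.
  · have hex : ∃ c ∈ C, ∀ a ∈ C, a ≠ c → ¬ H.Adj w a := by
      by_cases h : ∃ c ∈ C, H.Adj w c
      · obtain ⟨c, hc, hwc⟩ := h
        exact ⟨c, hc, fun a ha hac hwa => hac (huniq a ha c hc hwa hwc)⟩
      · push Not at h
        exact ⟨y, hyC, fun a ha _ => h a ha⟩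
    obtain ⟨c, hc, hcu⟩ := hex
    refine ⟨c, hCQ.trans hQF, hc, fun x hx hxc z hz hzC hxz => ?_⟩
    by_cases hzQ : z ∈ Q
    · by_cases hzw : z = w
      · exact hcu x hx hxc (hzw ▸ hxz.symm)
      · exact hzC (hclosed x hx z hzQ hzw hxz)
    · exact hpend x (hCQ hx) ((hCmem x).1 hx).2.1 z hz hzQ hxz
  · refine ⟨Finset.sdiff_subset.trans hQF, Finset.mem_sdiff.2 ⟨hw, hwC⟩, ?_⟩
    intro x hx hxw z hz hzQ hxz
    rw [Finset.mem_sdiff] at hx hzQ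
    by_cases hzC : z ∈ C
    · exact hx.2 (hclosed z hzC x hx.1 hxw hxz.symm)
    · exact hpend x hx.1 hxw z hz (fun h => hzQ ⟨h, hzC⟩) hxz

/-- Every forest on at least `s` vertices has a pendant set of between `s` and `2 s - 1`
vertices. -/
theorem exists_isPendant (hH : H.IsAcyclic) (F : Finset V) (s : ℕ) (hs : 1 ≤ s)
    (hF : s ≤ F.card) :
    ∃ Q w, IsPendant H F Q w ∧ s ≤ Q.card ∧ Q.card + 1 ≤ 2 * s := by
  have key : ∀ c : ℕ, ∀ Q w, IsPendant H F Q w → Q.card = c → s ≤ Q.card →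
      ∃ Q w, IsPendant H F Q w ∧ s ≤ Q.card ∧ Q.card + 1 ≤ 2 * s := by
    intro c
    induction c using Nat.strong_induction_on with
    | _ c ih =>
      intro Q w hQ hc hsQ
      by_cases hle : Q.card + 1 ≤ 2 * s
      · exact ⟨Q, w, hQ, hsQ, hle⟩
      obtain ⟨C, hCQ, hC, ⟨x, hx⟩, hQC⟩ := hQ.exists_split hH (by omega)
      have h1 := Finset.card_lt_card hCQ
      have h2 := hC.card_pos
      have h3 := Finset.card_sdiff_add_card_eq_card hCQ.1
      -- Here |Q| ≥ 2s, so one of the two pieces still has at least s vertices, and both are smaller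
      -- than Q.
      by_cases hsC : s ≤ C.card
      · exact ih _ (by omega) C x hx rfl hsC
      · exact ih _ (by omega) (Q \ C) w hQC rfl (by omega)
  obtain ⟨w, hw⟩ : F.Nonempty := Finset.card_pos.1 (by omega)
  exact key _ F w ⟨subset_rfl, hw, fun x _ _ y hy hyF => absurd hy hyF⟩ rfl hF

end Separator

/-! ### The embedding lemma in terms of positions -/

section Embedding

variable {V : Type*} [DecidableEq V] {H : SimpleGraph V}

/-- `φ` embeds the subgraph of `H` induced by `A` into `B(k)`. -/
def IsPosEmb (H : SimpleGraph V) (k : ℕ) (A : Finset V) (φ : V → ℕ) : Prop :=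
  Set.InjOn φ A ∧ ∀ a ∈ A, ∀ b ∈ A, H.Adj a b → PosAdj k (φ a) (φ b)

omit [DecidableEq V] in
theorem isPosEmb_singleton (H : SimpleGraph V) (k : ℕ) (v : V) (φ : V → ℕ) :
    IsPosEmb H k {v} φ := by
  refine ⟨by simp, fun a ha b hb hab => ?_⟩
  rw [Finset.mem_singleton] at ha hb
  exact absurd (ha.trans hb.symm) hab.ne

theorem IsPosEmb.glue {k : ℕ} {P R : Finset V} {φ ψ : V → ℕ} (hφ : IsPosEmb H k P φ)
    (hψ : IsPosEmb H k R ψ) (hd : Disjoint P R) (hne : ∀ a ∈ P, ∀ b ∈ R, φ a ≠ ψ b)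
    (hadj : ∀ a ∈ P, ∀ b ∈ R, H.Adj a b → PosAdj k (φ a) (ψ b)) :
    ∃ χ : V → ℕ, IsPosEmb H k (P ∪ R) χ ∧ (∀ a ∈ P, χ a = φ a) ∧ (∀ a ∈ R, χ a = ψ a) := by
  have h1 : ∀ a ∈ P, (if a ∈ P then φ a else ψ a) = φ a := fun a ha => if_pos ha
  have h2 : ∀ a ∈ R, (if a ∈ P then φ a else ψ a) = ψ a :=
    fun a ha => if_neg (Finset.disjoint_right.1 hd ha)
  refine ⟨fun a => if a ∈ P then φ a else ψ a, ⟨?_, ?_⟩, h1, h2⟩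
  · intro a ha b hb hab
    simp only [Finset.coe_union, Set.mem_union, Finset.mem_coe] at ha hb
    rcases ha with ha | ha <;> rcases hb with hb | hb <;> simp only [h2, ha, hb] at hab
    · exact hφ.1 ha hb hab
    · exact absurd hab (hne a ha b hb)
    · exact absurd hab.symm (hne b hb a ha)
    · exact hψ.1 ha hb hab
  · intro a ha b hb hab
    rw [Finset.mem_union] at ha hb
    rcases ha with ha | ha <;> rcases hb with hb | hb <;> simp only [h2, ha, hb]
    · exact hφ.2 a ha b hb hab
    · exact hadj a ha b hb hab
    · exact (hadj b hb a ha hab.symm).symm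
    · exact hψ.2 a ha b hb hab

/-- `H` restricted to `A` embeds into the last vertices among the first `n` vertices of `B(k)`. -/
def FinalEmbeds (H : SimpleGraph V) (k n : ℕ) (A : Finset V) (v : V) : Prop :=
  ∃ φ : V → ℕ, IsPosEmb H k A φ ∧ (∀ a ∈ A, n ≤ φ a + A.card ∧ φ a < n) ∧
    φ v = rootPos k n A.card

/-- Adding a vertex adjacent to everything. -/
theorem IsPosEmb.insert_vertex {k : ℕ} {A : Finset V} {v : V} {φ : V → ℕ} (hv : v ∈ A)
    (hφ : IsPosEmb H k (A.erase v) φ) (r : ℕ)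
    (hr : ∀ a ∈ A.erase v, r ≠ φ a ∧ PosAdj k r (φ a)) :
    ∃ χ : V → ℕ, IsPosEmb H k A χ ∧ χ v = r ∧ (∀ a ∈ A.erase v, χ a = φ a) := by
  obtain ⟨χ, h1, h2, h3⟩ := (isPosEmb_singleton H k v (fun _ => r)).glue hφ (by simp)
    (fun a _ b hb => (hr b hb).1) (fun a _ b hb _ => (hr b hb).2)
  refine ⟨χ, ?_, h2 v (by simp), h3⟩
  rwa [← Finset.insert_eq, Finset.insert_erase hv] at h1

omit [DecidableEq V] in
/-- Embedding a possibly empty set, without prescribing the image of a vertex. -/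
theorem exists_isPosEmb {k n m : ℕ} (hn : n ≤ treeSize k) {A : Finset V} (hm : A.card < m)
    (hA : A.card ≤ n)
    (ih : ∀ c < m, ∀ (k n : ℕ), n ≤ treeSize k → ∀ (A : Finset V) (v : V), v ∈ A → A.card = c →
      A.card ≤ n → FinalEmbeds H k n A v) :
    ∃ φ : V → ℕ, IsPosEmb H k A φ ∧ ∀ a ∈ A, n ≤ φ a + A.card ∧ φ a < n := by
  rcases A.eq_empty_or_nonempty with rfl | ⟨v, hv⟩
  · exact ⟨fun _ => 0, ⟨by simp, by simp⟩, by simp⟩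
  · obtain ⟨φ, h1, h2, -⟩ := ih _ hm k n hn A v hv rfl hA
    exact ⟨φ, h1, h2⟩

/-- Acyclicity suffices in place of connectedness, which lets the induction apply to the pieces left
after deleting v or cutting off Q. Prescribing the image of v is what later places the attachment
vertex w. -/
theorem finalEmbeds (hH : H.IsAcyclic) (m : ℕ) : ∀ (k n : ℕ), n ≤ treeSize k →
    ∀ (A : Finset V) (v : V), v ∈ A → A.card = m → A.card ≤ n → FinalEmbeds H k n A v := by
  induction m using Nat.strong_induction_on with
  | _ m ih =>
  intro k
  induction k with
  | zero =>
    intro n hn A v hv hA hAn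
    have h1 : 0 < A.card := Finset.card_pos.2 ⟨v, hv⟩
    simp only [treeSize] at hn
    have h2 : A.card = 1 := by omega
    obtain ⟨a, rfl⟩ := Finset.card_eq_one.1 h2
    exact ⟨fun _ => 0, isPosEmb_singleton _ _ _ _, fun _ _ => by simp at *; omega, rfl⟩
  | succ k ihk =>
  intro n hn A v hv hA hAn
  have hpos : 0 < A.card := Finset.card_pos.2 ⟨v, hv⟩
  have hF : (A.erase v).card + 1 = A.card := Finset.card_erase_add_one hv
  have hN := treeSize_succ k
  rcases hAn.eq_or_lt with hAn | hAn
  · obtain ⟨ψ, h1, h2⟩ := exists_isPosEmb (k := k + 1) (n := n) hn (m := m)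
      (A := A.erase v) (by omega) (by omega) ih
    obtain ⟨χ, h3, h4, h5⟩ := h1.insert_vertex hv 0 (fun a ha => by
      have := h2 a ha
      exact ⟨by omega, PosAdj.root _ (by omega) (by omega)⟩)
    refine ⟨χ, h3, fun a ha => ?_, by rw [h4, ← hAn, rootPos_self]⟩
    by_cases hav : a = v
    · rw [hav, h4]; omega
    · have ha' := Finset.mem_erase.2 ⟨hav, ha⟩
      have := h2 a ha'
      rw [h5 a ha']; omega
  -- No position in the right subtree is available and the root stays unused, so everything happens
  -- in the left subtree.
  by_cases hn1 : n ≤ 1 + treeSize k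
  · obtain ⟨ψ, h1, h2, h3⟩ := ihk (n - 1) (by omega) A v hv hA (by omega)
    refine ⟨fun a => 1 + ψ a, ⟨?_, ?_⟩, ?_, ?_⟩
    · intro a ha b hb hab
      exact h1.1 ha hb (by simpa using hab)
    · intro a ha b hb hab
      have := h2 a ha
      have := h2 b hb
      exact (h1.2 a ha b hb hab).left (by omega) (by omega)
    · intro a ha
      have := h2 a ha
      dsimp only
      omega
    · simp only [h3, rootPos_of_le hAn hn1]
  -- The available part of the right subtree is large enough for A.
  by_cases hn2 : A.card ≤ n - 1 - treeSize k
  · obtain ⟨ψ, h1, h2, h3⟩ := ihk (n - 1 - treeSize k) (by omega) A v hv hA (by omega)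
    refine ⟨fun a => 1 + treeSize k + ψ a, ⟨?_, ?_⟩, ?_, ?_⟩
    · intro a ha b hb hab
      exact h1.1 ha hb (by simpa using hab)
    · intro a ha b hb hab
      exact (h1.2 a ha b hb hab).right
    · intro a ha
      have := h2 a ha
      dsimp only
      omega
    · simp only [h3, rootPos_sub (by omega : 1 + treeSize k < n) hn2]
  have hroot : rootPos (k + 1) n A.card = 1 + treeSize k :=
    rootPos_cross hAn (by omega) (by omega)
  -- it suffices to embed the other vertices
  suffices h : ∃ φ : V → ℕ, IsPosEmb H (k + 1) (A.erase v) φ ∧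
      ∀ a ∈ A.erase v, n ≤ φ a + A.card ∧ φ a < n ∧ φ a ≠ 1 + treeSize k by
    obtain ⟨φ, h1, h2⟩ := h
    obtain ⟨χ, h3, h4, h5⟩ := h1.insert_vertex hv (1 + treeSize k) (fun a ha => by
      have := h2 a ha
      exact ⟨by omega, PosAdj.rightChild (by omega) (by omega) (by omega)⟩)
    refine ⟨χ, h3, fun a ha => ?_, by rw [h4, hroot]⟩
    by_cases hav : a = v
    · rw [hav, h4]; omega
    · have ha' := Finset.mem_erase.2 ⟨hav, ha⟩
      have := h2 a ha'
      rw [h5 a ha']; omega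
  -- The right child is the last available position, so the other vertices go directly in front of
  -- it.
  by_cases hn3 : n = treeSize k + 2
  · obtain ⟨ψ, h1, h2⟩ := exists_isPosEmb (k := k + 1) (n := n - 1) (by omega) (m := m)
      (A := A.erase v) (by omega) (by omega) ih
    exact ⟨ψ, h1, fun a ha => by have := h2 a ha; omega⟩
  -- B(1) has three vertices, so the cases above exhaust it.
  obtain _ | k := k
  · simp only [treeSize] at hn hn1 hn3; omega
  have hN' := treeSize_succ k
  have hN'' : treeSize (k + 2) = 2 * treeSize (k + 1) + 1 := rfl
  -- The last s positions lie in the left subtree of the right child.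
  by_cases hn4 : n ≤ treeSize (k + 1) + 2 + treeSize k
  · obtain ⟨s, rfl⟩ : ∃ s, n = treeSize (k + 1) + 2 + s := Nat.exists_eq_add_of_le (by omega)
    obtain ⟨Q, w, ⟨hQF, hwQ, hpend⟩, hQ1, hQ2⟩ :=
      exists_isPendant hH (A.erase v) s (by omega) (by omega)
    have hR := Finset.card_sdiff_add_card_eq_card hQF
    -- Q is embedded in a copy of B(k + 1) with s positions in its right subtree, then transferred
    -- to the middle subtrees. Since |Q| ≤ 2s - 1 and s ≤ `treeSize k`, the root of the copy is not
    -- used; since |Q| ≥ s, w lands on the root of its right subtree.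
    obtain ⟨ψ, h1, h2, h3⟩ := ih Q.card (by omega) (k + 1) (1 + treeSize k + s) (by omega) Q w hwQ
      rfl (by omega)
    rw [rootPos_cross (by omega) (by omega) (by omega)] at h3
    obtain ⟨χ, h4, h5⟩ := exists_isPosEmb (k := k + 2) (n := treeSize (k + 1) + 1 + s - Q.card)
      (by omega) (m := m) (A := A.erase v \ Q) (by omega) (by omega) ih
    have h6 : ∀ a ∈ Q, treeSize (k + 1) + 1 + s - Q.card ≤ middlePos k (ψ a) ∧
        middlePos k (ψ a) < treeSize (k + 1) + 2 + s ∧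
        middlePos k (ψ a) ≠ 1 + treeSize (k + 1) := by
      intro a ha
      have := h2 a ha
      unfold middlePos
      split_ifs <;> omega
    have h7 : IsPosEmb H (k + 2) Q (fun a => middlePos k (ψ a)) := by
      refine ⟨fun a ha b hb hab => h1.1 ha hb (middlePos_injective k hab), ?_⟩
      intro a ha b hb hab
      have := h2 a ha
      have := h2 b hb
      exact (h1.2 a ha b hb hab).middle (by omega) (by omega) (by omega) (by omega)
    have hw : middlePos k (ψ w) = 1 + treeSize (k + 1) + 1 := by
      rw [h3, middlePos, if_neg (by omega)]; omega
    obtain ⟨ξ, h8, h9, h10⟩ := h7.glue h4 Finset.disjoint_sdiff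
      (fun a ha b hb => by
        have := h6 a ha
        have := h5 b hb
        omega)
      (fun a ha b hb hab => by
        have hb' := Finset.mem_sdiff.1 hb
        have haw : a = w := by
          by_contra haw
          exact hpend a ha haw b hb'.1 hb'.2 hab
        have := h5 b hb
        simp only [haw, hw]
        exact PosAdj.rightLeft (by omega) (by omega))
    rw [Finset.union_sdiff_of_subset hQF] at h8
    refine ⟨ξ, h8, fun a ha => ?_⟩
    by_cases haQ : a ∈ Q
    · have := h6 a haQ
      rw [h9 a haQ]
      omega
    · have ha' := Finset.mem_sdiff.2 ⟨ha, haQ⟩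
      have := h5 a ha'
      rw [h10 a ha']
      omega
  -- Now the last s positions lie in the right subtree of the right child. The bounds on |Q| keep Q
  -- strictly below the right child of the root and put w on the right child of that child.
  · obtain ⟨s, rfl⟩ : ∃ s, n = treeSize (k + 1) + 2 + treeSize k + s :=
      Nat.exists_eq_add_of_le (by omega)
    obtain ⟨Q, w, ⟨hQF, hwQ, hpend⟩, hQ1, hQ2⟩ :=
      exists_isPendant hH (A.erase v) s (by omega) (by omega)
    have hvQ : v ∉ Q := fun h => (Finset.mem_erase.1 (hQF h)).1 rfl
    have hQA : Q ⊆ A := hQF.trans (Finset.erase_subset _ _)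
    have hR := Finset.card_sdiff_add_card_eq_card hQA
    obtain ⟨ψ, h1, h2, h3⟩ := ih Q.card (by omega) (k + 2)
      (treeSize (k + 1) + 2 + treeSize k + s) hn Q w hwQ rfl (by omega)
    rw [rootPos_sub (by omega) (by omega), rootPos_cross (by omega) (by omega) (by omega)] at h3
    -- Although v is placed separately, it is embedded here together with the rest: its image is
    -- forced to be the right child of the root, so dropping v afterwards leaves exactly that
    -- position free.
    obtain ⟨χ, h4, h5, h6⟩ := ih (A \ Q).card (by omega) (k + 2)
      (treeSize (k + 1) + 2 + treeSize k + s - Q.card) (by omega) (A \ Q) v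
      (Finset.mem_sdiff.2 ⟨hv, hvQ⟩) rfl (by omega)
    rw [rootPos_cross (by omega) (by omega) (by omega)] at h6
    have h4' : IsPosEmb H (k + 2) (A.erase v \ Q) χ :=
      ⟨h4.1.mono fun a ha => by simp at ha ⊢; tauto, fun a ha b hb =>
        h4.2 a (by simp at ha ⊢; tauto) b (by simp at hb ⊢; tauto)⟩
    have h7 : ∀ a ∈ A.erase v \ Q, treeSize (k + 1) + 2 + treeSize k + s ≤ χ a + A.card ∧
        χ a < treeSize (k + 1) + 2 + treeSize k + s - Q.card ∧ χ a ≠ 1 + treeSize (k + 1) := by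
      intro a ha
      have ha' : a ∈ A \ Q ∧ a ≠ v := by simp at ha ⊢; tauto
      have := h5 a ha'.1
      refine ⟨by omega, by omega, fun h => ha'.2 ?_⟩
      exact h4.1 ha'.1 (Finset.mem_sdiff.2 ⟨hv, hvQ⟩) (h.trans h6.symm)
    obtain ⟨ξ, h8, h9, h10⟩ := h1.glue h4' Finset.disjoint_sdiff
      (fun a ha b hb => by
        have := h2 a ha
        have := h7 b hb
        omega)
      (fun a ha b hb hab => by
        have hb' := Finset.mem_sdiff.1 hb
        have haw : a = w := by
          by_contra haw
          exact hpend a ha haw b hb'.1 hb'.2 hab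
        have := h7 b hb
        rw [haw, h3]
        exact PosAdj.rightRight (by omega) (by omega) (by omega))
    rw [Finset.union_sdiff_of_subset hQF] at h8
    refine ⟨ξ, h8, fun a ha => ?_⟩
    by_cases haQ : a ∈ Q
    · have := h2 a haQ
      rw [h9 a haQ]
      omega
    · have ha' := Finset.mem_sdiff.2 ⟨ha, haQ⟩
      have := h7 a ha'
      rw [h10 a ha']
      omega

end Embedding

/-! ### Positions, addresses and the preorder -/

theorem addr_length_le (k i : ℕ) : (addr k i).length ≤ k := by
  induction k generalizing i with
  | zero => simp [addr]
  | succ k ih =>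
    unfold addr
    split_ifs <;> simp [ih]

theorem addr_lt_addr {k i j : ℕ} (hij : i < j) (hj : j < treeSize k) : addr k i < addr k j := by
  induction k generalizing i j with
  | zero => simp only [treeSize] at hj; omega
  | succ k ih =>
    rw [treeSize_succ] at hj
    by_cases hi0 : i = 0
    · subst hi0
      rw [addr_zero]
      unfold addr
      split_ifs
      · omega
      · exact List.nil_lt_cons _ _
      · exact List.nil_lt_cons _ _
    by_cases hj1 : j ≤ treeSize k
    · obtain ⟨i, rfl⟩ := Nat.exists_eq_add_of_le (show 1 ≤ i by omega)
      obtain ⟨j, rfl⟩ := Nat.exists_eq_add_of_le (show 1 ≤ j by omega)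
      rw [addr_left (by omega), addr_left (by omega), List.cons_lt_cons_iff]
      exact Or.inr ⟨rfl, ih (by omega) (by omega)⟩
    obtain ⟨j, rfl⟩ := Nat.exists_eq_add_of_le (show 1 + treeSize k ≤ j by omega)
    by_cases hi1 : i ≤ treeSize k
    · obtain ⟨i, rfl⟩ := Nat.exists_eq_add_of_le (show 1 ≤ i by omega)
      rw [addr_left (by omega), addr_right, List.cons_lt_cons_iff]
      exact Or.inl (by decide)
    · obtain ⟨i, rfl⟩ := Nat.exists_eq_add_of_le (show 1 + treeSize k ≤ i by omega)
      rw [addr_right, addr_right, List.cons_lt_cons_iff]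
      exact Or.inr ⟨rfl, ih (by omega) (by omega)⟩

theorem exists_addr_eq {k : ℕ} {l : List Bool} (h : l.length ≤ k) :
    ∃ i < treeSize k, addr k i = l := by
  induction k generalizing l with
  | zero => exact ⟨0, by simp [treeSize], by simp_all [addr]⟩
  | succ k ih =>
    cases l with
    | nil => exact ⟨0, treeSize_pos _, addr_zero _⟩
    | cons c l =>
      obtain ⟨i, hi, rfl⟩ := ih (l := l) (by simpa using h)
      cases c
      · exact ⟨1 + i, by rw [treeSize_succ]; omega, addr_left hi⟩
      · exact ⟨1 + treeSize k + i, by rw [treeSize_succ]; omega, addr_right k i⟩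

theorem rootPos_lt {k n m : ℕ} (h0 : 0 < m) (hm : m ≤ n) : rootPos k n m < n := by
  induction k generalizing n with
  | zero => exact h0.trans_le hm
  | succ k ih =>
    unfold rootPos
    split_ifs with h1 h2 h3
    · omega
    · have := ih (n := n - 1) (by omega)
      omega
    · have := ih (n := n - 1 - treeSize k) h3
      omega
    · omega

/-- This links the recursive `rootPos` to the description by descendants: all later available
positions are below it, and its parent is a proper ancestor of all m final positions. -/
theorem exists_rootPos_parent {k n m : ℕ} (hm : 0 < m) (hmn : m < n) (hn : n ≤ treeSize k) :
    (∀ j, rootPos k n m ≤ j → j < n → addr k (rootPos k n m) <+: addr k j) ∧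
    ∃ p c, addr k (rootPos k n m) = p ++ [c] ∧
      ∀ j, n ≤ j + m → j < n → p <+: addr k j ∧ p ≠ addr k j := by
  induction k generalizing n with
  | zero => simp only [treeSize] at hn; omega
  | succ k ih =>
    have hN := treeSize_succ k
    have hnil : ∀ j, 0 < j → [] ≠ addr (k + 1) j := by
      intro j hj
      unfold addr
      split_ifs
      · omega
      · simp
      · simp
    by_cases hn1 : n ≤ 1 + treeSize k
    · obtain ⟨n, rfl⟩ : ∃ n', n = 1 + n' := Nat.exists_eq_add_of_le (by omega)
      rw [rootPos_of_le hmn hn1, Nat.add_sub_cancel_left]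
      rcases (show m ≤ n by omega).eq_or_lt with rfl | hlt
      · rw [rootPos_self, addr_left (treeSize_pos k), addr_zero]
        refine ⟨fun j hj hjm => ?_, [], false, rfl, fun j hj _ => ⟨List.nil_prefix, hnil j ?_⟩⟩
        · obtain ⟨j, rfl⟩ := Nat.exists_eq_add_of_le hj
          rw [add_zero, addr_left (by omega)]
          simp
        · omega
      · obtain ⟨h1, p, c, h2, h3⟩ := ih hlt (by omega)
        have hX : rootPos k n m < treeSize k := 
          (rootPos_lt hm hlt.le).trans_le (by omega)
        rw [addr_left hX]
        refine ⟨fun j hj hjm => ?_, false :: p, c, by rw [h2]; rfl, fun j hj hjm => ?_⟩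
        · obtain ⟨j, rfl⟩ := Nat.exists_eq_add_of_le (show 1 ≤ j by omega)
          rw [addr_left (by omega), List.prefix_cons_inj]
          exact h1 j (by omega) (by omega)
        · obtain ⟨j, rfl⟩ := Nat.exists_eq_add_of_le (show 1 ≤ j by omega)
          rw [addr_left (by omega), List.prefix_cons_inj]
          have := h3 j (by omega) (by omega)
          exact ⟨this.1, fun h => this.2 (List.cons_injective h)⟩
    obtain ⟨n, rfl⟩ : ∃ n', n = 1 + treeSize k + n' := Nat.exists_eq_add_of_le (by omega)
    by_cases hn2 : m < n
    · rw [rootPos_sub (by omega) (by omega), addr_right,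
        show 1 + treeSize k + n - 1 - treeSize k = n by omega]
      obtain ⟨h1, p, c, h2, h3⟩ := ih hn2 (by omega)
      refine ⟨fun j hj hjm => ?_, true :: p, c, by rw [h2]; rfl, fun j hj hjm => ?_⟩
      · obtain ⟨j, rfl⟩ := Nat.exists_eq_add_of_le (show 1 + treeSize k ≤ j by omega)
        rw [addr_right, List.prefix_cons_inj]
        exact h1 j (by omega) (by omega)
      · obtain ⟨j, rfl⟩ := Nat.exists_eq_add_of_le (show 1 + treeSize k ≤ j by omega)
        rw [addr_right, List.prefix_cons_inj]
        have := h3 j (by omega) (by omega)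
        exact ⟨this.1, fun h => this.2 (List.cons_injective h)⟩
    · rw [rootPos_cross hmn (by omega) (by omega)]
      have h0 := addr_right k 0
      rw [add_zero, addr_zero] at h0
      rw [h0]
      refine ⟨fun j hj hjm => ?_, [], true, rfl, fun j hj _ => ⟨List.nil_prefix, hnil j (by omega)⟩⟩
      obtain ⟨j, rfl⟩ := Nat.exists_eq_add_of_le hj
      rw [addr_right]
      simp

/-! ### From recursive arcs to the rules (G1), (G2), (G3) -/

theorem CrossArc.eq_nil_or {u w : List Bool} (h : CrossArc u w) :
    u = [] ∨ ∃ j c, u = List.replicate j false ++ [c] ∧ List.replicate j true <+: w := by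
  induction h with
  | nil w => exact Or.inl rfl
  | single c w => exact Or.inr ⟨0, c, rfl, List.nil_prefix⟩
  | @cons u w h ih =>
    right
    rcases ih with rfl | ⟨j, c, rfl, hw⟩
    · exact ⟨0, false, rfl, List.nil_prefix⟩
    · exact ⟨j + 1, c, rfl, by rw [List.replicate_succ, List.prefix_cons_inj]; exact hw⟩

/-- The alternatives correspond to (G1), (G2), (G3). In the last one q is the branching point, and
the parent q10...0 of u has nearest left cousin q01...1, its binary predecessor. -/
theorem TreeArc.prefix_or {u w : List Bool} (h : TreeArc u w) :
    (u <+: w ∧ u ≠ w) ∨ (∃ p, u = p ++ [true] ∧ p ++ [false] <+: w) ∨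
    ∃ q j c, u = q ++ true :: List.replicate j false ++ [c] ∧
      q ++ false :: List.replicate j true <+: w := by
  induction h with
  | root c w => exact Or.inl ⟨List.nil_prefix, by simp⟩
  | cons c h ih =>
    rcases ih with ⟨h1, h2⟩ | ⟨p, rfl, h2⟩ | ⟨q, j, d, rfl, h2⟩
    · exact Or.inl ⟨by rwa [List.prefix_cons_inj], fun h => h2 (List.cons_injective h)⟩
    · exact Or.inr (Or.inl ⟨c :: p, rfl, by simpa using h2⟩)
    · exact Or.inr (Or.inr ⟨c :: q, j, d, rfl, by simpa using h2⟩)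
  | cross h =>
    rcases h.eq_nil_or with rfl | ⟨j, c, rfl, hw⟩
    · exact Or.inr (Or.inl ⟨[], rfl, by simp⟩)
    · exact Or.inr (Or.inr ⟨[], j, c, rfl, by simpa using hw⟩)

theorem bool_cons_le_cons_iff {c d : Bool} {u w : List Bool} :
    c :: u ≤ d :: w ↔ c < d ∨ c = d ∧ u ≤ w := by
  rw [← not_lt, List.cons_lt_cons_iff]
  grind

theorem nil_le_list (l : List Bool) : [] ≤ l := not_lt.1 (List.not_lt_nil l)

theorem le_replicate_true (l : List Bool) : l ≤ List.replicate l.length true := by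
  induction l with
  | nil => simp
  | cons c l ih =>
    rw [List.length_cons, List.replicate_succ, bool_cons_le_cons_iff]
    cases c
    · exact Or.inl (by decide)
    · exact Or.inr ⟨rfl, ih⟩

theorem replicate_false_le (l : List Bool) : List.replicate l.length false ≤ l := by
  induction l with
  | nil => simp
  | cons c l ih =>
    rw [List.length_cons, List.replicate_succ, bool_cons_le_cons_iff]
    cases c
    · exact Or.inr ⟨rfl, ih⟩
    · exact Or.inl (by decide)

/-- The binary predecessor is the largest smaller list of the same length. -/
theorem le_of_lt_append_replicate {q l : List Bool} {j : ℕ}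
    (hl : l.length = (q ++ true :: List.replicate j false).length)
    (h : l < q ++ true :: List.replicate j false) :
    l ≤ q ++ false :: List.replicate j true := by
  induction q generalizing l with
  | nil =>
    cases l with
    | nil => simp at hl
    | cons c l =>
      obtain rfl : l.length = j := by simpa using hl
      rw [List.nil_append, List.cons_lt_cons_iff] at h
      rcases h with h | ⟨rfl, h⟩
      · obtain rfl : c = false := by cases c <;> simp_all
        rw [List.nil_append, bool_cons_le_cons_iff]
        exact Or.inr ⟨rfl, le_replicate_true l⟩
      · exact absurd h (not_lt.2 (replicate_false_le l))
  | cons d q ih =>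
    cases l with
    | nil => simp at hl
    | cons c l =>
      rw [List.cons_append, List.cons_lt_cons_iff] at h
      rw [List.cons_append, bool_cons_le_cons_iff]
      exact h.imp id fun h => ⟨h.1, ih (by simpa using hl) h.2⟩

theorem append_lt_append (q : List Bool) {l l' : List Bool} (h : l < l') : q ++ l < q ++ l' := by
  induction q with
  | nil => exact h
  | cons c q ih =>
    rw [List.cons_append, List.cons_append, List.cons_lt_cons_iff]
    exact Or.inr ⟨rfl, ih⟩

theorem le_of_prefix {u w : List Bool} (h : u <+: w) : u ≤ w := by
  obtain ⟨t, rfl⟩ := h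
  induction u with
  | nil => exact nil_le_list _
  | cons c u ih => rw [List.cons_append, bool_cons_le_cons_iff]; exact Or.inr ⟨rfl, ih⟩

theorem mem_perfectBinaryTree {k : ℕ} {u : List Bool} :
    u ∈ (perfectBinaryTree k).verts ↔ u.length ≤ k := by
  simp [perfectBinaryTree]

open DFSTree

theorem arc_of_treeArc {k : ℕ} {u w : (perfectBinaryTree k).V} (h : TreeArc u.1 w.1) :
    Arc u w := by
  obtain ⟨u, hu⟩ := u
  obtain ⟨w, hw⟩ := w
  rw [mem_perfectBinaryTree] at hu
  rcases h.prefix_or with ⟨h1, h2⟩ | ⟨p, h1, h2⟩ | ⟨q, j, c, h1, h2⟩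
  · exact Or.inl ⟨h1, fun h => h2 (congrArg Subtype.val h).symm⟩
  · right; left
    dsimp only at h1 h2
    subst h1
    simp only [List.length_append, List.length_singleton] at hu
    refine ⟨⟨p ++ [false], mem_perfectBinaryTree.2 (by simpa using hu)⟩, ⟨⟨⟨p,
      mem_perfectBinaryTree.2 (by omega)⟩, ⟨false, rfl⟩, ⟨true, rfl⟩⟩, ?_⟩, h2⟩
    exact append_lt_append p (by decide)
  · right; right
    dsimp only at h1 h2
    subst h1
    simp only [List.length_append, List.length_cons, List.length_replicate, List.length_nil] at hu
    refine ⟨⟨q ++ true :: List.replicate j false, mem_perfectBinaryTree.2 (by simp; omega)⟩,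
      ⟨q ++ false :: List.replicate j true, mem_perfectBinaryTree.2 (by simp; omega)⟩,
      ⟨c, rfl⟩, ⟨⟨by simp [level], ?_⟩, ?_⟩, h2⟩
    · exact append_lt_append q (by rw [List.cons_lt_cons_iff]; exact Or.inl (by decide))
    · rintro ⟨y, hy⟩ ⟨hy1, hy2⟩
      exact le_of_lt_append_replicate hy1 hy2

/-! ### Admissible sets as initial intervals; universality -/

/-- The `i`-th vertex of `B(k)` in the DFS preorder. -/
def vertexAt (k i : ℕ) : (perfectBinaryTree k).V :=
  ⟨addr k i, mem_perfectBinaryTree.2 (addr_length_le k i)⟩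

theorem vertexAt_lt_iff {k i j : ℕ} (hi : i < treeSize k) (hj : j < treeSize k) :
    vertexAt k i < vertexAt k j ↔ i < j := by
  refine ⟨fun h => ?_, fun h => addr_lt_addr h hj⟩
  by_contra hij
  rcases (not_lt.1 hij).eq_or_lt with rfl | hij
  · exact lt_irrefl _ h
  · exact lt_asymm h (addr_lt_addr hij hi)

theorem vertexAt_le_iff {k i j : ℕ} (hi : i < treeSize k) (hj : j < treeSize k) :
    vertexAt k i ≤ vertexAt k j ↔ i ≤ j := by
  rw [← not_lt, vertexAt_lt_iff hj hi, not_lt]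

theorem vertexAt_injOn (k : ℕ) {i j : ℕ} (hi : i < treeSize k) (hj : j < treeSize k)
    (h : vertexAt k i = vertexAt k j) : i = j :=
  le_antisymm ((vertexAt_le_iff hi hj).1 h.le) ((vertexAt_le_iff hj hi).1 h.ge)

theorem exists_vertexAt_eq {k : ℕ} (x : (perfectBinaryTree k).V) :
    ∃ i < treeSize k, vertexAt k i = x := by
  obtain ⟨i, hi, h⟩ := exists_addr_eq (mem_perfectBinaryTree.1 x.2)
  exact ⟨i, hi, Subtype.ext h⟩

theorem generatedGraph_adj_of_posAdj {k i j : ℕ} (hi : i < treeSize k) (hj : j < treeSize k)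
    (hij : i ≠ j) (h : PosAdj k i j) :
    (perfectBinaryTree k).generatedGraph.Adj (vertexAt k i) (vertexAt k j) := by
  rw [generatedGraph, SimpleGraph.fromRel_adj]
  exact ⟨fun h => hij (vertexAt_injOn k hi hj h), h.imp arc_of_treeArc arc_of_treeArc⟩

/-- An admissible set consists of the first vertices in the DFS preorder. -/
theorem vertexAt_mem_iff {k : ℕ} {S : Finset (perfectBinaryTree k).V} (hS : Admissible S) :
    S.card ≤ treeSize k ∧ ∀ i < treeSize k, vertexAt k i ∈ S ↔ i < S.card := by
  classical
  let I := (Finset.range (treeSize k)).filter fun i => vertexAt k i ∈ S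
  have hI : I.card = S.card := by
    apply Finset.card_bij (fun i _ => vertexAt k i)
    · intro i hi
      exact (Finset.mem_filter.1 hi).2
    · intro i hi j hj h
      simp only [I, Finset.mem_filter, Finset.mem_range] at hi hj
      exact vertexAt_injOn k hi.1 hj.1 h
    · intro x hx
      obtain ⟨i, hi, rfl⟩ := exists_vertexAt_eq x
      exact ⟨i, by simp [I, hi, hx], rfl⟩
  have hIc : I.card ≤ treeSize k := by
    simpa using Finset.card_le_card (Finset.filter_subset (fun i => vertexAt k i ∈ S)
      (Finset.range (treeSize k)))
  refine ⟨hI ▸ hIc, fun i hi => ⟨fun h => ?_, fun h => ?_⟩⟩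
  · have : Finset.range (i + 1) ⊆ I := by
      intro j hj
      rw [Finset.mem_range] at hj
      have hj' : j < treeSize k := by omega
      simp only [I, Finset.mem_filter, Finset.mem_range]
      exact ⟨hj', hS ((vertexAt_le_iff hj' hi).2 (by omega)) h⟩
    have := Finset.card_le_card this
    rw [Finset.card_range] at this
    omega
  · by_contra hiS
    have : I ⊆ Finset.range i := by
      intro j hj
      simp only [I, Finset.mem_filter, Finset.mem_range] at hj ⊢
      by_contra hij
      exact hiS (hS ((vertexAt_le_iff hi hj.1).2 (by omega)) hj.2)
    have := Finset.card_le_card this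
    rw [Finset.card_range] at this
    omega

/-- Proper descendants come after their ancestor, so those in S occupy positions strictly between i
and |S|. -/
theorem add_descCard_le_card {k i : ℕ} {S : Finset (perfectBinaryTree k).V} (hS : Admissible S)
    (hi : i < S.card) : i + 1 + descCard S (vertexAt k i) ≤ S.card := by
  obtain ⟨hc, hmem⟩ := vertexAt_mem_iff hS
  have hsub : (S : Set (perfectBinaryTree k).V) ∩ desc (vertexAt k i) ⊆
      vertexAt k '' (Finset.Ioo i S.card : Finset ℕ) := by
    rintro x ⟨hxS, hx1, hx2⟩
    obtain ⟨j, hj, rfl⟩ := exists_vertexAt_eq x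
    refine ⟨j, ?_, rfl⟩
    rw [Finset.mem_coe, Finset.mem_Ioo]
    refine ⟨?_, (hmem j hj).1 hxS⟩
    have h1 : vertexAt k i ≤ vertexAt k j := le_of_prefix hx1
    rw [vertexAt_le_iff (by omega) hj] at h1
    exact lt_of_le_of_ne h1 fun h => hx2 (h ▸ rfl)
  have h1 := Set.ncard_le_ncard hsub (Set.toFinite _)
  have h2 := Set.ncard_image_le (f := vertexAt k) (Finset.finite_toSet (Finset.Ioo i S.card))
  rw [Set.ncard_coe_finset, Nat.card_Ioo] at h2
  unfold descCard
  omega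

theorem exists_admissibleEmbedding {k : ℕ} {S : Finset (perfectBinaryTree k).V}
    (hS : Admissible S) {m : ℕ} {H : SimpleGraph (Fin m)} (hH : H.IsTree) (hm : m ≤ S.card)
    (v : Fin m) :
    ∃ φ : Fin m → (perfectBinaryTree k).V,
      IsAdmissibleEmbedding H S φ ∧
      (m = S.card → φ v = (perfectBinaryTree k).root) ∧
      (m < S.card → IsGreatest
        {x : (perfectBinaryTree k).V | x ∈ Set.range φ ∧ descCard S x < m ∧
          ∀ p : (perfectBinaryTree k).V, IsParent p x → m ≤ descCard S p} (φ v)) := by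
  obtain ⟨hc, hmem⟩ := vertexAt_mem_iff hS
  obtain ⟨ψ, ⟨hinj, hadj⟩, hrange, hv⟩ := finalEmbeds (H := H) hH.isAcyclic m k S.card hc
    Finset.univ v (Finset.mem_univ v) (by simp) (by simpa using hm)
  simp only [Finset.card_univ, Fintype.card_fin, Finset.mem_univ, forall_const] at hrange hv hadj
  have hlt : ∀ a, ψ a < treeSize k := fun a => (hrange a).2.trans_le hc
  have hinj' : Function.Injective ψ := fun a b h => hinj (by simp) (by simp) h
  -- An injection of m points into an interval of length m is onto; hence the uncovered set is
  -- initial.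
  have himg : ∀ j, S.card ≤ j + m → j < S.card → ∃ a, ψ a = j := by
    intro j hj1 hj2
    have h1 : Finset.univ.image ψ = Finset.Ico (S.card - m) S.card := by
      apply Finset.eq_of_subset_of_card_le
      · intro i hi
        obtain ⟨a, -, rfl⟩ := Finset.mem_image.1 hi
        have := hrange a
        rw [Finset.mem_Ico]
        omega
      · rw [Finset.card_image_of_injective _ hinj', Nat.card_Ico, Finset.card_univ,
          Fintype.card_fin]
        omega
    have h2 : j ∈ Finset.univ.image ψ := by
      rw [h1, Finset.mem_Ico]
      omega
    simpa using h2
  refine ⟨fun a => vertexAt k (ψ a), ⟨?_, ?_, ?_, ?_⟩, ?_, ?_⟩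
  · exact fun a b h => hinj' (vertexAt_injOn k (hlt a) (hlt b) h)
  · exact fun a => (hmem _ (hlt a)).2 (hrange a).2
  · exact fun a b hab => generatedGraph_adj_of_posAdj (hlt a) (hlt b)
      (fun h => hab.ne (hinj' h)) (hadj a b hab)
  · rintro x y hyx ⟨hxS, hx⟩
    refine ⟨hS hyx hxS, ?_⟩
    rintro ⟨a, rfl⟩
    obtain ⟨j, hj, rfl⟩ := exists_vertexAt_eq x
    have hle := (vertexAt_le_iff (hlt a) hj).1 hyx
    have := hrange a
    obtain ⟨b, rfl⟩ := himg j (by omega) ((hmem j hj).1 hxS)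
    exact hx ⟨b, rfl⟩
  · intro h
    apply Subtype.ext
    change addr k (ψ v) = []
    rw [hv, ← h, rootPos_self, addr_zero]
  · intro hlt'
    have hm0 : 0 < m := v.pos
    obtain ⟨h1, p, c, h2, h3⟩ := exists_rootPos_parent hm0 hlt' hc
    rw [← hv] at h1 h2
    have hvr := hrange v
    refine ⟨⟨⟨v, rfl⟩, ?_, ?_⟩, ?_⟩
    · have := add_descCard_le_card hS hvr.2
      dsimp only
      omega
    · rintro ⟨q, hq⟩ ⟨d, hd⟩
      obtain rfl : p = q := (List.append_inj' (h2.symm.trans hd) rfl).1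
      have hsub : Set.range (fun a => vertexAt k (ψ a)) ⊆
          (S : Set (perfectBinaryTree k).V) ∩ desc ⟨p, hq⟩ := by
        rintro _ ⟨a, rfl⟩
        have h4 := h3 (ψ a) (hrange a).1 (hrange a).2
        exact ⟨(hmem _ (hlt a)).2 (hrange a).2, h4.1,
          fun h => h4.2 (congrArg Subtype.val h).symm⟩
      have h5 := Set.ncard_le_ncard hsub (Set.toFinite _)
      rw [← Set.image_univ, Set.ncard_image_of_injective _
        (fun a b h => hinj' (vertexAt_injOn k (hlt a) (hlt b) h)), Set.ncard_univ,
        Nat.card_fin] at h5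
      exact h5
    · rintro _ ⟨⟨a, rfl⟩, -, hpar⟩
      refine (vertexAt_le_iff (hlt a) (hlt v)).2 ?_
      by_contra hva
      rw [not_le] at hva
      have hpre := h1 (ψ a) hva.le (hrange a).2
      have hne : addr k (ψ v) ≠ addr k (ψ a) := fun h => (addr_lt_addr hva (hlt a)).ne h
      obtain ⟨t, ht⟩ := hpre
      rcases List.eq_nil_or_concat' t with rfl | ⟨t, d, rfl⟩
      · exact hne (by simpa using ht)
      have hlen := addr_length_le k (ψ a)
      rw [← ht, ← List.append_assoc, List.length_append] at hlen
      -- A later image is a proper descendant of the image of v, so its parent, at position i, is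
      -- not before the image of v. Fewer than m positions of S follow i, so this parent has too few
      -- descendants.
      obtain ⟨i, hi, hi'⟩ := exists_addr_eq (k := k) (l := addr k (ψ v) ++ t) (by omega)
      have h6 := hpar (vertexAt k i) ⟨d, by
        change addr k (ψ a) = addr k i ++ [d]
        rw [← ht, hi', List.append_assoc]⟩
      have h7 : ψ v ≤ i := (vertexAt_le_iff (hlt v) hi).1
        (le_of_prefix (show addr k (ψ v) <+: addr k i from ⟨t, hi'.symm⟩))
      have h8 : i ≤ ψ a := (vertexAt_le_iff hi (hlt a)).1
        (le_of_prefix (show addr k i <+: addr k (ψ a) from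
          ⟨[d], by rw [hi', ← ht, List.append_assoc]⟩))
      have h9 := hrange a
      have := add_descCard_le_card hS (h8.trans_lt h9.2)
      omega

theorem treeUniversal_of_admissible {k : ℕ} {S : Finset (perfectBinaryTree k).V}
    (hS : Admissible S) :
    TreeUniversal S.card
      ((perfectBinaryTree k).generatedGraph.induce (S : Set (perfectBinaryTree k).V)) := by
  intro H hH
  obtain ⟨v⟩ := hH.connected.nonempty
  obtain ⟨φ, h, -⟩ := exists_admissibleEmbedding hS hH le_rfl v
  refine ⟨⟨⟨fun a => ⟨φ a, h.mem a⟩, fun {a b} hab => h.map_adj a b hab⟩, ?_⟩⟩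
  exact fun a b hab => h.injective (congrArg Subtype.val hab)

/-! ### Counting edges -/

/-- An upper bound for the number of vertices of `B(k)` below a vertex with address `u`. -/
def weight (k : ℕ) (u : List Bool) : ℕ := 2 ^ (k + 1 - u.length)

theorem weight_cons (k : ℕ) (c : Bool) (u : List Bool) : weight (k + 1) (c :: u) = weight k u := by
  simp [weight]

theorem weight_nil (k : ℕ) : weight k [] = 2 ^ (k + 1) := rfl

theorem sum_weight_succ_of_le {k n : ℕ} (hn : n ≤ treeSize k) :
    ∑ i ∈ Finset.range (1 + n), weight (k + 1) (addr (k + 1) i) =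
      2 ^ (k + 2) + ∑ i ∈ Finset.range n, weight k (addr k i) := by
  rw [Finset.sum_range_add, Finset.sum_range_one, addr_zero, weight_nil]
  congr 1
  refine Finset.sum_congr rfl fun i hi => ?_
  rw [addr_left ((Finset.mem_range.1 hi).trans_le hn), weight_cons]

theorem sum_weight_succ (k n : ℕ) :
    ∑ i ∈ Finset.range (1 + treeSize k + n), weight (k + 1) (addr (k + 1) i) =
      2 ^ (k + 2) + ∑ i ∈ Finset.range (treeSize k), weight k (addr k i) +
        ∑ i ∈ Finset.range n, weight k (addr k i) := by
  rw [Finset.sum_range_add, sum_weight_succ_of_le le_rfl]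
  congr 1
  refine Finset.sum_congr rfl fun i _ => ?_
  rw [addr_right, weight_cons]

theorem sum_weight_treeSize (k : ℕ) :
    ∑ i ∈ Finset.range (treeSize k), weight k (addr k i) = (k + 1) * 2 ^ (k + 1) := by
  induction k with
  | zero => simp [treeSize, weight, addr]
  | succ k ih =>
    rw [show treeSize (k + 1) = 1 + treeSize k + treeSize k by rw [treeSize_succ]; ring,
      sum_weight_succ, ih]
    ring

/-- The slack doubles with each level: half of it pays for the new root, the other half is the slack
of the one incomplete subtree. A complete left subtree together with the root has `2 ^ (k + 1)`
vertices, whose share covers the exact sum `sum_weight_treeSize`. -/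
theorem sum_weight_le {k n : ℕ} (hn : n ≤ treeSize k) :
    ∑ i ∈ Finset.range n, weight k (addr k i) ≤ (k + 1) * n + 2 ^ (k + 2) := by
  induction k generalizing n with
  | zero =>
    simp only [treeSize] at hn
    interval_cases n <;> simp [weight, addr]
  | succ k ih =>
    have hN := treeSize_eq k
    rw [treeSize_succ] at hn
    rcases Nat.eq_zero_or_pos n with rfl | hpos
    · simp
    by_cases h : n ≤ 1 + treeSize k
    · obtain ⟨n, rfl⟩ := Nat.exists_eq_add_of_le hpos
      have h' : n ≤ treeSize k := by omega
      rw [Nat.succ_eq_add_one, Nat.zero_add, sum_weight_succ_of_le h']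
      have h1 := ih h'
      have h2 : 2 ^ (k + 1 + 2) = 2 * 2 ^ (k + 2) := by ring
      nlinarith
    · obtain ⟨n, rfl⟩ := Nat.exists_eq_add_of_le (not_le.1 h).le
      rw [sum_weight_succ, sum_weight_treeSize]
      have h1 := ih (n := n) (by omega)
      have h2 : 2 ^ (k + 1 + 2) = 2 * 2 ^ (k + 2) := by ring
      have h3 : 2 ^ (k + 2) = 2 * 2 ^ (k + 1) := by ring
      have h4 : 1 + treeSize k = 2 ^ (k + 1) := by omega
      rw [h4]
      nlinarith

/-- A vertex with address `x` has fewer than `2 ^ (k + 1 - |x|)` descendants. -/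
theorem card_prefix_le (k : ℕ) (x : List Bool) :
    ((Finset.range (treeSize k)).filter fun i => x <+: addr k i).card ≤ weight k x := by
  induction k generalizing x with
  | zero =>
    refine (Finset.card_filter_le _ _).trans ?_
    rw [Finset.card_range]
    exact Nat.one_le_two_pow
  | succ k ih =>
    cases x with
    | nil =>
      refine (Finset.card_filter_le _ _).trans ?_
      have := treeSize_eq (k + 1)
      rw [Finset.card_range, weight_nil]
      omega
    | cons c x =>
      rw [weight_cons]
      refine le_trans ?_ (ih x)
      have hN := treeSize_succ k
      let o := if c then 1 + treeSize k else 1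
      have hsub : ((Finset.range (treeSize (k + 1))).filter fun i => c :: x <+: addr (k + 1) i) ⊆
          ((Finset.range (treeSize k)).filter fun i => x <+: addr k i).image fun i => o + i := by
        intro i hi
        simp only [Finset.mem_filter, Finset.mem_range, Finset.mem_image] at hi ⊢
        obtain ⟨hi, hx⟩ := hi
        rcases Nat.eq_zero_or_pos i with rfl | hpos
        · simp [addr_zero] at hx
        by_cases h : i ≤ treeSize k
        · obtain ⟨i, rfl⟩ := Nat.exists_eq_add_of_le (show 1 ≤ i from hpos)
          rw [addr_left (by omega), List.cons_prefix_cons] at hx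
          exact ⟨i, ⟨by omega, hx.2⟩, by simp [o, hx.1]⟩
        · obtain ⟨i, rfl⟩ := Nat.exists_eq_add_of_le (show 1 + treeSize k ≤ i by omega)
          rw [addr_right, List.cons_prefix_cons] at hx
          exact ⟨i, ⟨by omega, hx.2⟩, by simp [o, hx.1]⟩
      exact (Finset.card_le_card hsub).trans Finset.card_image_le

open Classical in
theorem card_closedDesc_le {k : ℕ} (S : Finset (perfectBinaryTree k).V)
    (x : (perfectBinaryTree k).V) : (S.filter fun w => w ∈ closedDesc x).card ≤ weight k x.1 := by
  refine le_trans ?_ (card_prefix_le k x.1)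
  have hsub : (S.filter fun w => w ∈ closedDesc x) ⊆
      ((Finset.range (treeSize k)).filter fun i => x.1 <+: addr k i).image (vertexAt k) := by
    intro w hw
    obtain ⟨i, hi, rfl⟩ := exists_vertexAt_eq w
    exact Finset.mem_image_of_mem _
      (Finset.mem_filter.2 ⟨Finset.mem_range.2 hi, (Finset.mem_filter.1 hw).2⟩)
  exact (Finset.card_le_card hsub).trans Finset.card_image_le

theorem isLeftSibling_iff {k : ℕ} {x u : (perfectBinaryTree k).V} :
    IsLeftSibling x u ↔ ∃ p, x.1 = p ++ [false] ∧ u.1 = p ++ [true] := by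
  constructor
  · rintro ⟨⟨p, ⟨c, hc⟩, d, hd⟩, hlt⟩
    have hlt' : x.1 < u.1 := hlt
    rw [hc, hd] at hlt'
    have hcd : c = false ∧ d = true := by
      cases c <;> cases d <;> simp only [and_self, and_true, and_false, reduceCtorEq]
      · exact lt_irrefl _ hlt'
      · exact lt_asymm hlt' (append_lt_append _ (by decide))
      · exact lt_irrefl _ hlt'
    exact ⟨p.1, by rw [hc, hcd.1], by rw [hd, hcd.2]⟩
  · rintro ⟨p, hx, hu⟩
    have hp := mem_perfectBinaryTree.1 u.2
    rw [hu, List.length_append] at hp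
    refine ⟨⟨⟨p, mem_perfectBinaryTree.2 (by omega)⟩, ⟨false, hx⟩, ⟨true, hu⟩⟩, ?_⟩
    change x.1 < u.1
    rw [hx, hu]
    exact append_lt_append _ (by decide)

/-- `u` is a right child. -/
def IsRightChild {k : ℕ} (u : (perfectBinaryTree k).V) : Prop := ∃ p, u.1 = p ++ [true]

-- The left sibling has the weight of u; the nearest left cousin of the parent lies one level higher
-- and has twice that weight.
open Classical in
theorem card_arc_le {k : ℕ} (S : Finset (perfectBinaryTree k).V) (u : (perfectBinaryTree k).V) :
    (S.filter fun w => Arc u w).card ≤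
      3 * weight k u.1 + if IsRightChild u then weight k u.1 else 0 := by
  let S₁ := S.filter fun w => w ∈ desc u
  let S₂ := S.filter fun w => ∃ x, IsLeftSibling x u ∧ w ∈ closedDesc x
  let S₃ := S.filter fun w => ∃ p x, IsParent p u ∧ IsNearestLeftCousin x p ∧ w ∈ closedDesc x
  have h1 : S₁.card ≤ weight k u.1 :=
    (Finset.card_le_card (Finset.monotone_filter_right S fun w _ hw => hw.1)).trans
      (card_closedDesc_le S u)
  have h2 : S₂.card ≤ if IsRightChild u then weight k u.1 else 0 := by
    by_cases h : ∃ x, IsLeftSibling x u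
    · obtain ⟨x, hx⟩ := h
      obtain ⟨p, hxp, hup⟩ := isLeftSibling_iff.1 hx
      rw [if_pos ⟨p, hup⟩, show weight k u.1 = weight k x.1 by simp [weight, hxp, hup]]
      refine (Finset.card_le_card ?_).trans (card_closedDesc_le S x)
      refine Finset.monotone_filter_right S ?_
      rintro w _ ⟨y, hy, hw⟩
      obtain ⟨q, hyq, huq⟩ := isLeftSibling_iff.1 hy
      obtain rfl : p = q := (List.append_inj' (hup.symm.trans huq) rfl).1
      obtain rfl : x = y := Subtype.ext (hxp.trans hyq.symm)
      exact hw
    · have : S₂ = ∅ := Finset.filter_false_of_mem fun w _ ⟨x, hx, _⟩ => h ⟨x, hx⟩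
      simp [this]
  have h3 : S₃.card ≤ 2 * weight k u.1 := by
    by_cases h : ∃ p x, IsParent p u ∧ IsNearestLeftCousin x p
    · obtain ⟨p, x, ⟨c, hp⟩, hx⟩ := h
      have hlen : x.1.length = p.1.length := hx.1.1
      have hul := mem_perfectBinaryTree.1 u.2
      rw [hp, List.length_append, List.length_singleton] at hul
      have hw2 : 2 * weight k u.1 = weight k x.1 := by
        unfold weight
        rw [hp, hlen, List.length_append, List.length_singleton, ← pow_succ']
        congr 1
        omega
      rw [hw2]
      refine (Finset.card_le_card ?_).trans (card_closedDesc_le S x)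
      refine Finset.monotone_filter_right S ?_
      rintro w _ ⟨q, y, ⟨d, hq⟩, hy, hw⟩
      obtain rfl : p = q := Subtype.ext (List.append_inj' (hp.symm.trans hq) rfl).1
      obtain rfl : x = y := hx.unique hy
      exact hw
    · have : S₃ = ∅ :=
        Finset.filter_false_of_mem fun w _ ⟨p, x, hp, hx, _⟩ => h ⟨p, x, hp, hx⟩
      simp [this]
  have h4 : (S.filter fun w => Arc u w) ⊆ S₁ ∪ (S₂ ∪ S₃) := by
    intro w hw
    simp only [S₁, S₂, S₃, Finset.mem_union, Finset.mem_filter] at hw ⊢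
    exact hw.2.imp (fun h => ⟨hw.1, h⟩) (Or.imp (fun h => ⟨hw.1, h⟩) (fun h => ⟨hw.1, h⟩))
  have h5 := Finset.card_le_card h4
  have h6 := Finset.card_union_le S₁ (S₂ ∪ S₃)
  have h7 := Finset.card_union_le S₂ S₃
  omega

open Classical in
/-- In an admissible set, right children have at most half of the total weight. -/
theorem two_mul_sum_isRightChild_le {k : ℕ} {S : Finset (perfectBinaryTree k).V}
    (hS : Admissible S) :
    2 * ∑ u ∈ S, (if IsRightChild u then weight k u.1 else 0) ≤ ∑ u ∈ S, weight k u.1 := by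
  rw [← Finset.sum_filter, two_mul, ← Finset.sum_filter_add_sum_filter_not S IsRightChild]
  refine add_le_add le_rfl ?_
  -- A right child is paired with its left sibling, which has equal weight, precedes it and
  -- therefore lies in S, and is not a right child.
  have hsib : ∀ u : (perfectBinaryTree k).V, ∃ x : (perfectBinaryTree k).V,
      IsRightChild u → IsLeftSibling x u := by
    intro u
    by_cases hu : IsRightChild u
    · obtain ⟨p, hp⟩ := hu
      have hul := mem_perfectBinaryTree.1 u.2
      rw [hp, List.length_append] at hul
      exact ⟨⟨p ++ [false], mem_perfectBinaryTree.2 (by simpa using hul)⟩,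
        fun _ => isLeftSibling_iff.2 ⟨p, rfl, hp⟩⟩
    · exact ⟨u, fun h => absurd h hu⟩
  choose f hf using hsib
  have hinj : Set.InjOn f (S.filter IsRightChild : Finset _) := by
    intro u hu v hv huv
    obtain ⟨p, h1, h2⟩ := isLeftSibling_iff.1 (hf u (Finset.mem_filter.1 hu).2)
    obtain ⟨q, h3, h4⟩ := isLeftSibling_iff.1 (hf v (Finset.mem_filter.1 hv).2)
    rw [huv] at h1
    obtain rfl : p = q := (List.append_inj' (h1.symm.trans h3) rfl).1
    exact Subtype.ext (h2.trans h4.symm)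
  calc ∑ u ∈ S.filter IsRightChild, weight k u.1
      = ∑ u ∈ S.filter IsRightChild, weight k (f u).1 := by
        refine Finset.sum_congr rfl fun u hu => ?_
        obtain ⟨p, h1, h2⟩ := isLeftSibling_iff.1 (hf u (Finset.mem_filter.1 hu).2)
        simp [weight, h1, h2]
    _ = ∑ x ∈ (S.filter IsRightChild).image f, weight k x.1 :=
        (Finset.sum_image (f := fun x => weight k x.1) hinj).symm
    _ ≤ ∑ u ∈ S.filter fun u => ¬ IsRightChild u, weight k u.1 := by
        refine Finset.sum_le_sum_of_subset fun x hx => ?_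
        obtain ⟨u, hu, rfl⟩ := Finset.mem_image.1 hx
        obtain ⟨huS, hu⟩ := Finset.mem_filter.1 hu
        refine Finset.mem_filter.2 ⟨hS (hf u hu).2.le huS, ?_⟩
        rintro ⟨q, hq⟩
        obtain ⟨p, h1, -⟩ := isLeftSibling_iff.1 (hf u hu)
        have := (List.append_inj' (h1.symm.trans hq) rfl).2
        simp at this

open Classical in
theorem ncard_edgeSet_induce_le {k : ℕ} (S : Finset (perfectBinaryTree k).V) :
    ((perfectBinaryTree k).generatedGraph.induce
      (S : Set (perfectBinaryTree k).V)).edgeSet.ncard ≤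
      ∑ u ∈ S, (S.filter fun w => Arc u w).card := by
  set G := (perfectBinaryTree k).generatedGraph.induce (S : Set (perfectBinaryTree k).V)
  let P : Finset (Σ _ : (perfectBinaryTree k).V, (perfectBinaryTree k).V) :=
    S.sigma fun u => S.filter fun w => Arc u w
  have hP : P.card = ∑ u ∈ S, (S.filter fun w => Arc u w).card := Finset.card_sigma _ _
  have hinj : Function.Injective (Sym2.map (Subtype.val : S → (perfectBinaryTree k).V)) :=
    Sym2.map.injective Subtype.val_injective
  have hsub : Sym2.map (Subtype.val : S → (perfectBinaryTree k).V) '' G.edgeSet ⊆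
      (P.image fun e => s(e.1, e.2) : Finset _) := by
    rintro _ ⟨e, he, rfl⟩
    induction e with
    | _ a b =>
    have hab : (perfectBinaryTree k).generatedGraph.Adj a.1 b.1 := he
    rw [generatedGraph, SimpleGraph.fromRel_adj] at hab
    rw [Finset.mem_coe, Finset.mem_image]
    rcases hab.2 with h | h
    · exact ⟨⟨a.1, b.1⟩, Finset.mem_sigma.2 ⟨a.2, Finset.mem_filter.2 ⟨b.2, h⟩⟩, rfl⟩
    · exact ⟨⟨b.1, a.1⟩, Finset.mem_sigma.2 ⟨b.2, Finset.mem_filter.2 ⟨a.2, h⟩⟩, Sym2.eq_swap⟩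
  have h1 := Set.ncard_le_ncard hsub (Finset.finite_toSet _)
  rw [Set.ncard_image_of_injective _ hinj, Set.ncard_coe_finset] at h1
  exact h1.trans (Finset.card_image_le.trans hP.le)

theorem sum_weight_admissible {k : ℕ} {S : Finset (perfectBinaryTree k).V} (hS : Admissible S) :
    ∑ u ∈ S, weight k u.1 ≤ (k + 1) * S.card + 2 ^ (k + 2) := by
  obtain ⟨hc, hmem⟩ := vertexAt_mem_iff hS
  refine le_of_eq_of_le ?_ (sum_weight_le hc)
  symm
  refine Finset.sum_bij (fun i _ => vertexAt k i) ?_ ?_ ?_ (fun _ _ => rfl)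
  · intro i hi
    rw [Finset.mem_range] at hi
    exact (hmem i (by omega)).2 hi
  · intro i hi j hj h
    rw [Finset.mem_range] at hi hj
    exact vertexAt_injOn k (by omega) (by omega) h
  · intro x hx
    obtain ⟨i, hi, rfl⟩ := exists_vertexAt_eq x
    exact ⟨i, Finset.mem_range.2 ((hmem i hi).1 hx), rfl⟩

theorem two_mul_ncard_edgeSet_le {k : ℕ} {S : Finset (perfectBinaryTree k).V}
    (hS : Admissible S) :
    2 * ((perfectBinaryTree k).generatedGraph.induce
      (S : Set (perfectBinaryTree k).V)).edgeSet.ncard ≤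
      7 * ((k + 1) * S.card + 2 ^ (k + 2)) := by
  classical
  have h1 := ncard_edgeSet_induce_le S
  have h2 := Finset.sum_le_sum fun u (_ : u ∈ S) => card_arc_le S u
  rw [Finset.sum_add_distrib, ← Finset.mul_sum] at h2
  have h3 := two_mul_sum_isRightChild_le hS
  have h4 := sum_weight_admissible hS
  omega

theorem exists_admissible_card_eq {k n : ℕ} (hn : n ≤ treeSize k) :
    ∃ S : Finset (perfectBinaryTree k).V, Admissible S ∧ S.card = n := by
  classical
  refine ⟨(Finset.range n).image (vertexAt k), ?_, ?_⟩
  · intro x y hyx hx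
    simp only [Finset.coe_image, Finset.coe_range, Set.mem_image, Set.mem_Iio] at hx ⊢
    obtain ⟨i, hi, rfl⟩ := hx
    obtain ⟨j, hj, rfl⟩ := exists_vertexAt_eq y
    exact ⟨j, ((vertexAt_le_iff hj (by omega)).1 hyx).trans_lt hi, rfl⟩
  · rw [Finset.card_image_of_injOn, Finset.card_range]
    intro i hi j hj h
    rw [Finset.coe_range, Set.mem_Iio] at hi hj
    exact vertexAt_injOn k (by omega) (by omega) h

theorem exists_universal_admissible {n k : ℕ} (h1 : 2 ^ k ≤ n) (h2 : n < 2 ^ (k + 1)) :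
    ∃ S : Finset (perfectBinaryTree k).V, Admissible S ∧ S.card = n ∧
      TreeUniversal n
        ((perfectBinaryTree k).generatedGraph.induce (S : Set (perfectBinaryTree k).V)) ∧
      ((((perfectBinaryTree k).generatedGraph.induce
          (S : Set (perfectBinaryTree k).V)).edgeSet.ncard : ℕ) : ℝ) ≤
        7 / 2 * (n : ℝ) * Real.logb 2 n + 18 * n := by
  have hN := treeSize_eq k
  obtain ⟨S, hS, rfl⟩ := exists_admissible_card_eq (k := k) (n := n) (by omega)
  refine ⟨S, hS, rfl, treeUniversal_of_admissible hS, ?_⟩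
  have h3 := two_mul_ncard_edgeSet_le hS
  generalize (SimpleGraph.edgeSet _).ncard = E at h3 ⊢
  have hpos : 0 < S.card := (Nat.two_pow_pos k).trans_le h1
  have h4 : (k : ℝ) ≤ Real.logb 2 S.card := by
    rw [Real.le_logb_iff_rpow_le (by norm_num) (by exact_mod_cast hpos), Real.rpow_natCast]
    exact_mod_cast h1
  -- The linear terms add up to (7/2)(1 + 4)n = 17.5n, rounded up to 18n.
  have h5 : 2 ^ (k + 2) ≤ 4 * S.card := by rw [pow_add]; omega
  have h6 := h3.trans (Nat.mul_le_mul_left 7 (Nat.add_le_add_left h5 _))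
  have h7 := mul_le_mul_of_nonneg_left h4 (Nat.cast_nonneg (α := ℝ) S.card)
  have h8 := (Nat.cast_le (α := ℝ)).2 h6
  push_cast at h8
  have h9 : (0 : ℝ) ≤ S.card := Nat.cast_nonneg _
  nlinarith

/-! ### The bound on s(n) -/

theorem minUniversalEdges_le {n : ℕ} {U : Type} [Fintype U] (hU : Fintype.card U = n)
    {G : SimpleGraph U} (hG : TreeUniversal n G) : minUniversalEdges n ≤ G.edgeSet.ncard := by
  let e : Fin n ≃ U := (Fintype.equivFinOfCardEq hU).symm
  let f : G.comap e ≃g G := SimpleGraph.Iso.comap e G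
  refine Nat.sInf_le ⟨G.comap e, fun H hH => (hG H hH).trans ⟨f.symm.toCopy⟩, ?_⟩
  exact Nat.card_congr f.mapEdgeSet

theorem minUniversalEdges_zero : minUniversalEdges 0 = 0 := by
  have h : TreeUniversal 0 (⊥ : SimpleGraph (Fin 0)) := fun H hH => hH.connected.nonempty.elim Fin.elim0
  simpa using minUniversalEdges_le (by simp) h

theorem minUniversalEdges_le_logb (n : ℕ) :
    (minUniversalEdges n : ℝ) ≤ 7 / 2 * (n : ℝ) * Real.logb 2 n + 18 * n := by
  rcases Nat.eq_zero_or_pos n with rfl | hn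
  · simp [minUniversalEdges_zero]
  obtain ⟨S, -, hc, hU, hle⟩ := exists_universal_admissible (k := Nat.log 2 n)
    (Nat.pow_log_le_self 2 hn.ne') (Nat.lt_pow_succ_log_self one_lt_two n)
  refine le_trans (Nat.cast_le.2 (minUniversalEdges_le ?_ hU)) hle
  simpa using hc

open DFSTree in
theorem mainTheorem6 :
    -- the embedding lemma for admissible subgraphs of the graph generated by `B(k)`
    (∀ (k : ℕ) (S : Finset (perfectBinaryTree k).V), Admissible S →
      ∀ (m : ℕ) (H : SimpleGraph (Fin m)), H.IsTree → m ≤ S.card → ∀ v : Fin m,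
        ∃ φ : Fin m → (perfectBinaryTree k).V,
          IsAdmissibleEmbedding H S φ ∧
          (m = S.card → φ v = (perfectBinaryTree k).root) ∧
          (m < S.card → IsGreatest
            {x : (perfectBinaryTree k).V | x ∈ Set.range φ ∧ descCard S x < m ∧
              ∀ p : (perfectBinaryTree k).V, IsParent p x → m ≤ descCard S p} (φ v))) ∧
    -- every admissible subgraph is universal
    (∀ (k : ℕ) (S : Finset (perfectBinaryTree k).V), Admissible S →
      TreeUniversal S.card
        ((perfectBinaryTree k).generatedGraph.induce (S : Set (perfectBinaryTree k).V))) ∧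
    -- the number of edges of the construction, and the resulting bound on `s(n)`
    (∃ C : ℝ,
      (∀ n k : ℕ, 2 ^ k ≤ n → n < 2 ^ (k + 1) →
        ∃ S : Finset (perfectBinaryTree k).V, Admissible S ∧ S.card = n ∧
          TreeUniversal n
            ((perfectBinaryTree k).generatedGraph.induce (S : Set (perfectBinaryTree k).V)) ∧
          ((((perfectBinaryTree k).generatedGraph.induce
              (S : Set (perfectBinaryTree k).V)).edgeSet.ncard : ℕ) : ℝ) ≤
            7 / 2 * (n : ℝ) * Real.logb 2 n + C * n) ∧
      (∀ n : ℕ, (minUniversalEdges n : ℝ) ≤ 7 / 2 * (n : ℝ) * Real.logb 2 n + C * n)) := by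
  exact ⟨fun k S hS m H hH hm v => exists_admissibleEmbedding hS hH hm v,
    fun k S hS => treeUniversal_of_admissible hS,
    18, fun n k h1 h2 => exists_universal_admissible h1 h2, minUniversalEdges_le_logb⟩
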